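/- Let $\mathcal H$ be a complex separable Hilbert space and let $T$ be a bounded linear operator on $\mathcal H$. Then $T$ is essentially idempotent, i.e. $T^2 - T$ is compact, if and only if at least one of the following holds: (1) $T - I$ is compact; (2) $T$ is compact; (3) $T - S$ is compact for some bounded linear operator $S$ on $\mathcal H$ with $S^2 = S$ such that both the range $\mathcal R(S)$ of $S$ and the null space $\mathcal N(S^*)$ of the adjoint $S^*$ are infinite-dimensional. -/

import Mathlib

/-- A bounded operator `T` on a Hilbert space is essentially idempotent if `T ^ 2 - T` is compact. -/
def IsEssentiallyIdempotent {H : Type*} [NormedAddCommGroup H] [InnerProductSpace ℂ H]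
    (T : H →L[ℂ] H) : Prop :=
  IsCompactOperator (T ^ 2 - T : H →L[ℂ] H)

/-!
The content is that an idempotent of the Calkin algebra lifts to an idempotent operator.

Let `t` be the class of `T`, an idempotent, and put `h = 1 + (t - t*) (t* - t)`. This element is
invertible and commutes with `t` and `t*`, and `p = t h⁻¹ t*` is a projection with `t p = p` and
`p t = t` (Kaplansky's formula for the range projection of an idempotent). Since
`1 + (T - T*) (T* - T)` is already invertible as an operator, `p` is the class of an honest
self-adjoint operator `A`, and `A ^ 2 - A` is compact (`exists_isSelfAdjoint_rangeProjection`). A spectral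
value of `A` in `(0, 1)` gives a nonzero eigenvalue of the compact self-adjoint operator
`A ^ 2 - A`; in a separable space there are only countably many of those, so some `c ∈ (0, 1)` is
not in the spectrum of `A` (`exists_notMem_spectrum`). The indicator function of `(c, ∞)` is
continuous on the spectrum, and applied to `A` it gives a projection `Q` which differs from `A` by
a multiple of `A ^ 2 - A` (`exists_isIdempotentElem_sub_eq_mul`). Now `Q + Q T (1 - Q)` is an exact
idempotent, and it has the same class as `p + p t (1 - p) = t`.

The three cases of the theorem come from the size of the idempotent `S`: it has finite rank, or
`1 - S*` has finite rank, or both spaces are infinite-dimensional. Schauder's theorem on adjoints of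
compact operators is proved here for Hilbert spaces (`IsCompactOperator.adjoint`).
-/

open ContinuousLinearMap

/-! ### Idempotents in rings -/

section Ring

variable {R : Type*} [Ring R]

/-- Kaplansky's formula for the range projection, in purely algebraic form: `s` plays the role of
the adjoint of `t`, and `g` is the inverse of `1 + (t - s) * (s - t)`. -/
theorem IsIdempotentElem.rangeProjection {t s g : R} (ht : t * t = t) (hs : s * s = s)
    (hg : g * (1 + (t - s) * (s - t)) = 1) (hg' : (1 + (t - s) * (s - t)) * g = 1) :
    (t * g * s) * (t * g * s) = t * g * s ∧ t * (t * g * s) = t * g * s ∧ (t * g * s) * t = t := by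
  set h := 1 + (t - s) * (s - t) with hh
  have e : h = 1 - t - s + t * s + s * t := by
    rw [hh]
    simp only [mul_sub, sub_mul, ht, hs]
    abel
  have c1 : t * h = t * s * t := by
    rw [e]
    simp only [mul_add, mul_sub, mul_one, ← mul_assoc, ht]
    abel
  have c2 : h * t = t * s * t := by
    rw [e]
    simp only [add_mul, sub_mul, one_mul, mul_assoc, ht]
    abel
  have c3 : t * g = g * t := by
    calc t * g = g * (h * t) * g := by rw [← mul_assoc, hg, one_mul]
      _ = g * (t * h) * g := by rw [c1, c2]
      _ = g * t * (h * g) := by simp only [mul_assoc]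
      _ = g * t := by rw [hg', mul_one]
  have c4 : t * g * s * t = t := by
    rw [c3, mul_assoc, mul_assoc, ← mul_assoc t, ← c2, ← mul_assoc, hg, one_mul]
  refine ⟨?_, ?_, c4⟩
  · rw [← mul_assoc, ← mul_assoc, c4]
  · rw [← mul_assoc, ← mul_assoc, ht]

theorem IsIdempotentElem.add_mul_one_sub {q : R} (hq : IsIdempotentElem q) (t : R) :
    IsIdempotentElem (q + q * t * (1 - q)) := by
  have h1 : (1 - q) * q = 0 := by rw [sub_mul, one_mul, hq.eq, sub_self]
  have h2 : q * (q * t * (1 - q)) = q * t * (1 - q) := by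
    rw [← mul_assoc, ← mul_assoc, hq.eq]
  have h3 : q * t * (1 - q) * (q * t * (1 - q)) = 0 := by
    rw [mul_assoc (q * t), ← mul_assoc (1 - q), ← mul_assoc (1 - q), h1]; simp
  have h4 : q * t * (1 - q) * q = 0 := by rw [mul_assoc, h1, mul_zero]
  rw [IsIdempotentElem, add_mul, mul_add, mul_add, hq.eq, h2, h3, h4]
  simp

end Ring

/-! ### Projections in C*-algebras -/

section CStar

variable {A : Type*} [CStarAlgebra A]

theorem isUnit_one_add_mul_star_self (x : A) : IsUnit (1 + x * star x) :=
  let _ := CStarAlgebra.spectralOrder A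
  have := CStarAlgebra.spectralOrderedRing A
  CStarAlgebra.isUnit_of_le (1 : A) (le_add_of_nonneg_right (mul_star_self_nonneg x))

/-- Rounding the spectrum to `{0, 1}` across a gap of the spectrum in `(0, 1)`. -/
theorem exists_isIdempotentElem_sub_eq_mul {a : A} (ha : IsSelfAdjoint a) {c : ℝ} (h0 : 0 < c)
    (h1 : c < 1) (hc : c ∉ spectrum ℝ a) :
    ∃ q b : A, IsIdempotentElem q ∧ q - a = (a ^ 2 - a) * b := by
  have cont : ∀ u v : ℝ → ℝ, ContinuousOn u (Set.Iio c) → ContinuousOn v (Set.Ioi c) →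
      ContinuousOn (fun x => if x < c then u x else v x) (spectrum ℝ a) := by
    intro u v hu hv x hx
    rcases lt_or_gt_of_ne (fun h : x = c => hc (h ▸ hx)) with hxc | hxc
    · refine ((hu.continuousAt (Iio_mem_nhds hxc)).congr ?_).continuousWithinAt
      filter_upwards [Iio_mem_nhds hxc] with y hy
      exact (if_pos hy).symm
    · refine ((hv.continuousAt (Ioi_mem_nhds hxc)).congr ?_).continuousWithinAt
      filter_upwards [Ioi_mem_nhds hxc] with y hy
      exact (if_neg (not_lt.2 (le_of_lt hy))).symm
  let f : ℝ → ℝ := fun x => if x < c then 0 else 1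
  -- the quotient of `f x - x` by `x ^ 2 - x`
  let g : ℝ → ℝ := fun x => if x < c then (1 - x)⁻¹ else -x⁻¹
  have hf : ContinuousOn f (spectrum ℝ a) := cont _ _ continuousOn_const continuousOn_const
  have hg : ContinuousOn g (spectrum ℝ a) := by
    refine cont _ _ ?_ ?_
    · refine ContinuousOn.inv₀ (by fun_prop) fun x hx => ?_
      have : x < c := hx
      exact (by linarith : 0 < 1 - x).ne'
    · refine (ContinuousOn.inv₀ continuousOn_id fun x hx => ?_).neg
      exact (h0.trans hx).ne'
  refine ⟨cfc f a, cfc g a, ?_, ?_⟩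
  · rw [IsIdempotentElem, ← cfc_mul f f a hf hf]
    congr 1
    ext x
    by_cases hx : x < c <;> simp [f, hx]
  · have e1 : cfc f a - a = cfc (fun x => f x - x) a := by
      rw [cfc_sub f (fun x => x) a hf continuousOn_id, cfc_id' ℝ a]
    have e2 : a ^ 2 - a = cfc (fun x : ℝ => x ^ 2 - x) a := by
      rw [cfc_sub (fun x : ℝ => x ^ 2) (fun x => x) a (by fun_prop) continuousOn_id, cfc_id' ℝ a,
        cfc_pow_id a 2]
    rw [e1, e2, ← cfc_mul _ g a (by fun_prop) hg]
    congr 1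
    ext x
    by_cases hx : x < c
    · have : 1 - x ≠ 0 := by linarith
      simp only [f, g, hx, if_true]
      field_simp
      ring
    · have : x ≠ 0 := by linarith
      simp only [f, g, hx, if_false]
      field_simp
      ring

/-- If the image of `x` and the image of `star x` under a ring homomorphism are idempotent, then the
image of `x` has the same range projection as the image of some self-adjoint element. -/
theorem exists_isSelfAdjoint_rangeProjection {B : Type*} [Ring B] (π : A →+* B) {x : A}
    (hx : π x * π x = π x) (hx' : π (star x) * π (star x) = π (star x)) :
    ∃ a : A, IsSelfAdjoint a ∧ π a * π a = π a ∧ π x * π a = π a ∧ π a * π x = π x := by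
  obtain ⟨u, hu⟩ := isUnit_one_add_mul_star_self (x - star x)
  have hsa : star u = u := by
    refine Units.ext ?_
    rw [Units.coe_star, hu, star_add, star_one, star_mul, star_star]
  have hsa' : IsSelfAdjoint ((u⁻¹ : Aˣ) : A) := by
    have : star u⁻¹ = u⁻¹ := by rw [star_inv, hsa]
    exact congrArg Units.val this
  have hu' : π u = 1 + (π x - π (star x)) * (π (star x) - π x) := by
    rw [hu, star_sub, star_star, map_add, map_one, map_mul, map_sub, map_sub]
  refine ⟨x * ↑u⁻¹ * star x, hsa'.conjugate x, ?_⟩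
  simp only [map_mul]
  exact IsIdempotentElem.rangeProjection hx hx'
    (by rw [← hu', ← map_mul, Units.inv_mul, map_one])
    (by rw [← hu', ← map_mul, Units.mul_inv, map_one])

end CStar

/-! ### Compact operators on Hilbert spaces -/

section Hilbert

variable {H : Type*} [NormedAddCommGroup H] [InnerProductSpace ℂ H]

variable (H) in
/-- The two-sided ideal of compact operators in the algebra of all bounded operators; the quotient
by it is the Calkin algebra. -/
def compactIdeal : TwoSidedIdeal (H →L[ℂ] H) :=
  .mk' {T | IsCompactOperator T} isCompactOperator_zero (fun hx hy => hx.add hy) (fun hx => hx.neg)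
    (fun {x _} hy => hy.clm_comp x) (fun {_ y} hx => hx.comp_clm y)

theorem mem_compactIdeal {T : H →L[ℂ] H} : T ∈ compactIdeal H ↔ IsCompactOperator T :=
  TwoSidedIdeal.mem_mk' ..

variable (H) in
/-- The quotient map onto the Calkin algebra. -/
def calkinMap : (H →L[ℂ] H) →+* (compactIdeal H).ringCon.Quotient :=
  (compactIdeal H).ringCon.mk'

theorem calkinMap_eq_zero {T : H →L[ℂ] H} : calkinMap H T = 0 ↔ IsCompactOperator T := by
  rw [← mem_compactIdeal, ← TwoSidedIdeal.mem_ker, calkinMap, TwoSidedIdeal.ker_ringCon_mk']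

theorem calkinMap_eq {T S : H →L[ℂ] H} :
    calkinMap H T = calkinMap H S ↔ IsCompactOperator (T - S : H →L[ℂ] H) := by
  rw [← calkinMap_eq_zero, map_sub, sub_eq_zero]

theorem isCompactOperator_of_finiteDimensional_range {T : H →L[ℂ] H} (V : Submodule ℂ H)
    [FiniteDimensional ℂ V] (hT : ∀ x, T x ∈ V) : IsCompactOperator T := by
  have : LocallyCompactSpace V := have := FiniteDimensional.proper ℂ V; inferInstance
  have h : IsCompactOperator (T.codRestrict V hT) := 
    isCompactOperator_of_locallyCompactSpace_dom (T.codRestrict V hT)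
  exact h.clm_comp V.subtypeL

theorem isCompactOperator_sq_sub_self_of_sub {T S : H →L[ℂ] H} (hS : IsIdempotentElem S)
    (h : IsCompactOperator (T - S : H →L[ℂ] H)) : IsCompactOperator (T ^ 2 - T : H →L[ℂ] H) := by
  rw [← calkinMap_eq] at h ⊢
  rw [map_pow, h, ← map_pow, pow_two, hS.eq]

variable [CompleteSpace H]

/-- Schauder's theorem for Hilbert spaces. On the unit ball `‖T* z‖ ^ 2 = ⟪T T* z, z⟫` bounds
distances between the values of `T*` by those between the values of the compact operator `T T*`. -/
theorem IsCompactOperator.adjoint {T : H →L[ℂ] H} (hT : IsCompactOperator T) :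
    IsCompactOperator (ContinuousLinearMap.adjoint T) := by
  have key : ∀ z : H, ‖(ContinuousLinearMap.adjoint T) z‖ ^ 2 ≤
      ‖T (ContinuousLinearMap.adjoint T z)‖ * ‖z‖ := by
    intro z
    rw [← inner_self_eq_norm_sq (𝕜 := ℂ), adjoint_inner_right]
    exact (RCLike.re_le_norm _).trans (norm_inner_le_norm _ _)
  have hc : IsCompactOperator (T ∘L ContinuousLinearMap.adjoint T : H →L[ℂ] H) :=
    hT.comp_clm (ContinuousLinearMap.adjoint T)
  have htb := (hc.isCompact_closure_image_ball 1).totallyBounded.subset subset_closure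
  refine (isCompactOperator_iff_isCompact_closure_image_ball
    (ContinuousLinearMap.adjoint T : H →ₗ[ℂ] H) one_pos).2 ?_
  refine TotallyBounded.isCompact_of_isClosed (TotallyBounded.closure ?_) isClosed_closure
  set F : H → H := fun x => T (ContinuousLinearMap.adjoint T x) with hF
  change TotallyBounded (F '' Metric.ball 0 1) at htb
  rw [Metric.totallyBounded_iff]
  intro ε hε
  obtain ⟨t, hts, htf, hcov⟩ := Metric.finite_approx_of_totallyBounded htb (ε ^ 2 / 2) (by positivity)
  refine ⟨(fun y => ContinuousLinearMap.adjoint T (Function.invFunOn F (Metric.ball 0 1) y)) '' t,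
    htf.image _, ?_⟩
  rintro _ ⟨x, hx, rfl⟩
  obtain ⟨y, hyt, hy⟩ := Set.mem_iUnion₂.1 (hcov (Set.mem_image_of_mem F hx))
  refine Set.mem_iUnion₂.2 ⟨_, Set.mem_image_of_mem _ hyt, ?_⟩
  have hw := Function.invFunOn_mem (hts hyt)
  have hwy := Function.invFunOn_eq (hts hyt)
  set w := Function.invFunOn F (Metric.ball 0 1) y
  rw [mem_ball_zero_iff] at hx hw
  have hxw : ‖x - w‖ ≤ 2 := (norm_sub_le x w).trans (by linarith)
  have hd : ‖T (ContinuousLinearMap.adjoint T (x - w))‖ < ε ^ 2 / 2 := by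
    rw [Metric.mem_ball, dist_eq_norm, ← hwy] at hy
    simpa only [hF, map_sub] using hy
  rw [Metric.mem_ball, dist_eq_norm]
  change ‖ContinuousLinearMap.adjoint T x - ContinuousLinearMap.adjoint T w‖ < ε
  rw [← map_sub]
  refine lt_of_pow_lt_pow_left₀ 2 hε.le ((key _).trans_lt ?_)
  nlinarith [norm_nonneg (T (ContinuousLinearMap.adjoint T (x - w)))]

/-- Eigenvectors for distinct eigenvalues are orthogonal, so unit eigenvectors form a discrete
set. -/
theorem countable_eigenvalues [TopologicalSpace.SeparableSpace H] {T : H →L[ℂ] H}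
    (hT : IsSelfAdjoint T) : {μ : ℂ | Module.End.HasEigenvalue (T : Module.End ℂ H) μ}.Countable := by
  have hsymm : (T : H →ₗ[ℂ] H).IsSymmetric := hT.isSymmetric
  have hex : ∀ μ : {μ : ℂ | Module.End.HasEigenvalue (T : Module.End ℂ H) μ},
      ∃ v ∈ Module.End.eigenspace (T : Module.End ℂ H) μ.1, ‖v‖ = 1 := by
    rintro ⟨μ, hμ⟩
    obtain ⟨v, hv, hv0⟩ := hμ.exists_hasEigenvector
    refine ⟨((‖v‖ : ℂ)⁻¹) • v, Submodule.smul_mem _ _ hv, ?_⟩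
    rw [norm_smul, norm_inv, Complex.norm_real, norm_norm, inv_mul_cancel₀ (norm_ne_zero_iff.2 hv0)]
  choose v hv hv1 using hex
  refine Set.countable_coe_iff.1 (Pairwise.countable_of_isOpen_disjoint
    (s := fun μ => Metric.ball (v μ) (1 / 2)) ?_ (fun _ => Metric.isOpen_ball)
    fun μ => ⟨v μ, Metric.mem_ball_self (by norm_num)⟩)
  intro μ ν hμν
  refine Metric.ball_disjoint_ball ?_
  have h0 : inner ℂ (v μ) (v ν) = 0 :=
    hsymm.orthogonalFamily_eigenspaces (fun h => hμν (Subtype.ext h)) ⟨v μ, hv μ⟩ ⟨v ν, hv ν⟩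
  have h2 : ‖v μ - v ν‖ ^ 2 = 2 := by
    rw [@norm_sub_sq ℂ, h0, hv1, hv1]; norm_num
  rw [dist_eq_norm]
  nlinarith [norm_nonneg (v μ - v ν)]

/-- An essentially idempotent self-adjoint operator has a gap in its spectrum inside `(0, 1)`, because
`c ^ 2 - c` is a nonzero eigenvalue of a compact self-adjoint operator for each spectral value `c`
there. -/
theorem exists_notMem_spectrum [TopologicalSpace.SeparableSpace H] {A : H →L[ℂ] H}
    (hA : IsSelfAdjoint A) (hK : IsCompactOperator (A ^ 2 - A : H →L[ℂ] H)) :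
    ∃ c : ℝ, 0 < c ∧ c < 1 ∧ c ∉ spectrum ℝ A := by
  have hK' : IsSelfAdjoint (A ^ 2 - A) := (hA.pow 2).sub hA
  -- on `(0, 1 / 2)` the map `c ↦ c ^ 2 - c` is injective
  have hcount : (Set.Ioo (0 : ℝ) (1 / 2) ∩ (fun c : ℝ => ((c ^ 2 - c : ℝ) : ℂ)) ⁻¹'
      {μ : ℂ | Module.End.HasEigenvalue ((A ^ 2 - A : H →L[ℂ] H) : Module.End ℂ H) μ}).Countable := by
    refine Set.MapsTo.countable_of_injOn (f := fun c : ℝ => ((c ^ 2 - c : ℝ) : ℂ))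
      (fun c hc => hc.2) ?_ (countable_eigenvalues hK')
    intro c hc d hd h
    have h' : c ^ 2 - c = d ^ 2 - d := Complex.ofReal_injective h
    have h3 : (c - d) * (c + d - 1) = 0 := by linarith
    rcases mul_eq_zero.1 h3 with h4 | h4
    · linarith
    · linarith [hc.1.2, hd.1.2]
  have hunc : ¬ (Set.Ioo (0 : ℝ) (1 / 2)).Countable := by
    intro h
    have := Cardinal.mk_Ioo_real (show (0 : ℝ) < 1 / 2 by norm_num)
    exact absurd (Cardinal.le_aleph0_iff_set_countable.2 h)
      (by rw [this]; exact not_le.2 Cardinal.aleph0_lt_continuum)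
  by_contra! hall
  refine hunc (hcount.mono (Set.subset_inter subset_rfl fun c hc => ?_))
  have hspec : c ∈ spectrum ℝ A := hall c hc.1 (by linarith [hc.2])
  have hmem : c ^ 2 - c ∈ spectrum ℝ (A ^ 2 - A) := by
    have e2 : A ^ 2 - A = cfc (fun x : ℝ => x ^ 2 - x) A := by
      rw [cfc_sub (fun x : ℝ => x ^ 2) (fun x => x) A (by fun_prop) continuousOn_id, cfc_id' ℝ A,
        cfc_pow_id A 2]
    have := cfc_map_spectrum (fun x : ℝ => x ^ 2 - x) A hA (by fun_prop)
    rw [e2, this]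
    exact ⟨c, hspec, rfl⟩
  have hne : ((c ^ 2 - c : ℝ) : ℂ) ≠ 0 := by
    rw [Complex.ofReal_ne_zero]
    nlinarith [hc.1, hc.2]
  refine (hK.hasEigenvalue_iff_mem_spectrum hne).2 ?_
  exact (spectrum.algebraMap_mem_iff ℂ (r := c ^ 2 - c)).2 hmem

/-- Idempotents lift from the Calkin algebra. -/
theorem exists_isIdempotentElem_isCompactOperator_sub [TopologicalSpace.SeparableSpace H]
    {T : H →L[ℂ] H} (hT : IsCompactOperator (T ^ 2 - T : H →L[ℂ] H)) :
    ∃ S : H →L[ℂ] H, IsIdempotentElem S ∧ IsCompactOperator (T - S : H →L[ℂ] H) := by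
  have ht : calkinMap H T * calkinMap H T = calkinMap H T := by
    rw [← map_mul, ← pow_two, calkinMap_eq]; exact hT
  have ht' : calkinMap H (star T) * calkinMap H (star T) = calkinMap H (star T) := by
    rw [← map_mul, ← pow_two, calkinMap_eq, ← star_pow, ← star_sub]; exact hT.adjoint
  obtain ⟨A, hA, h0, h1, h2⟩ := exists_isSelfAdjoint_rangeProjection (calkinMap H) ht ht'
  have hAc : IsCompactOperator (A ^ 2 - A : H →L[ℂ] H) := by
    rw [← calkinMap_eq, pow_two, map_mul, h0]
  obtain ⟨c, hc0, hc1, hc⟩ := exists_notMem_spectrum hA hAc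
  obtain ⟨q, b, hq, hqb⟩ := exists_isIdempotentElem_sub_eq_mul hA hc0 hc1 hc
  have hqA : calkinMap H q = calkinMap H A := by
    rw [calkinMap_eq, hqb]; exact hAc.comp_clm b
  refine ⟨q + q * T * (1 - q), hq.add_mul_one_sub T, ?_⟩
  rw [← calkinMap_eq, map_add, map_mul, map_mul, map_sub, map_one, hqA, h2, mul_sub, mul_one, h1,
    add_sub_cancel]

end Hilbert

theorem theorem5p1 {H : Type*} [NormedAddCommGroup H] [InnerProductSpace ℂ H] [CompleteSpace H]
    [TopologicalSpace.SeparableSpace H] (T : H →L[ℂ] H) :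
    IsEssentiallyIdempotent T ↔
      IsCompactOperator (T - 1 : H →L[ℂ] H) ∨
      IsCompactOperator T ∨
      ∃ S : H →L[ℂ] H, IsIdempotentElem S ∧
        ¬ FiniteDimensional ℂ S.range ∧
        ¬ FiniteDimensional ℂ (ContinuousLinearMap.adjoint S).ker ∧
        IsCompactOperator (T - S : H →L[ℂ] H) := by
  constructor
  · intro hT
    obtain ⟨S, hS, hTS⟩ := exists_isIdempotentElem_isCompactOperator_sub hT
    by_cases hr : FiniteDimensional ℂ S.range
    · have hSc := isCompactOperator_of_finiteDimensional_range S.range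
        fun x => LinearMap.mem_range_self _ x
      exact .inr (.inl (by simpa using hTS.add hSc))
    by_cases hk : FiniteDimensional ℂ (ContinuousLinearMap.adjoint S).ker
    · -- `1 - S*` maps into the null space of the idempotent `S*`
      have hc : IsCompactOperator (star (1 - S) : H →L[ℂ] H) := by
        refine isCompactOperator_of_finiteDimensional_range (ContinuousLinearMap.adjoint S).ker ?_
        have h0 : star S * star (1 - S) = 0 := by
          rw [← star_mul, sub_mul, one_mul, hS.eq, sub_self, star_zero]
        exact fun x => LinearMap.mem_ker.2 (DFunLike.congr_fun h0 x)
      have hc' : IsCompactOperator (1 - S : H →L[ℂ] H) := by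
        have := hc.adjoint
        rwa [← star_eq_adjoint, star_star] at this
      refine .inl ?_
      have h := hTS.sub hc'
      rw [← calkinMap_eq] at hTS hc' ⊢
      rw [hTS, hc']
    exact .inr (.inr ⟨S, hS, hr, hk, hTS⟩)
  · rintro (h | h | ⟨S, hS, -, -, h⟩)
    · exact isCompactOperator_sq_sub_self_of_sub IsIdempotentElem.one h
    · exact isCompactOperator_sq_sub_self_of_sub IsIdempotentElem.zero (by simpa using h)
    · exact isCompactOperator_sq_sub_self_of_sub hS h
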